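/- Let $X$ be a reflexive real Banach space with topological dual $X^*$, let $C\subseteq X$ be nonempty, closed and convex, and let $F:C\times C\to\mathbb{R}$ satisfy $F(x,x)=0$ for all $x\in C$ and be monotone, i.e. $F(x,y)+F(y,x)\le 0$ for all $x,y\in C$. Suppose that for every $x\in C$ the function $F(x,\cdot)$ is convex and lower semicontinuous on $C$, and that for every $y\in C$ the function $F(\cdot,y)$ is upper hemicontinuous on $C$, i.e. upper semicontinuous on each line segment contained in $C$. Then $F$ is maximal monotone: the operator $A^F:X\rightrightarrows X^*$ given by $$A^F(x)=\{x^*\in X^*: F(x,y)-F(x,x)\ge\langle x^*,y-x\rangle\ \text{for all } y\in C\}\ \text{ if } x\in C,\qquad A^F(x)=\emptyset\ \text{ if } x\notin C,$$ is a maximal monotone operator, i.e. $\langle y^*-x^*,y-x\rangle\ge 0$ whenever $x^*\in A^F(x)$ and $y^*\in A^F(y)$, and the graph $\{(x,x^*): x^*\in A^F(x)\}$ is not properly included in the graph of any other operator $S:X\rightrightarrows X^*$ that is monotone in this sense. -/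

import Mathlib

namespace MonotoneBifunction

variable {X : Type*} [NormedAddCommGroup X] [NormedSpace ℝ X]

/-- A normed space is reflexive if the canonical injection into its bidual is onto. -/
def IsReflexive (X : Type*) [NormedAddCommGroup X] [NormedSpace ℝ X] : Prop :=
  Function.Surjective (NormedSpace.inclusionInDoubleDual ℝ X)

/-- The graph of a multifunction `T : X ⇉ X*`. -/
def graph (T : X → Set (StrongDual ℝ X)) : Set (X × StrongDual ℝ X) :=
  {p | p.2 ∈ T p.1}

/-- Monotone operators `T : X ⇉ X*`. -/
def IsMonotoneOperator (T : X → Set (StrongDual ℝ X)) : Prop :=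
  ∀ x y : X, ∀ xs ∈ T x, ∀ ys ∈ T y, 0 ≤ (ys - xs) (y - x)

/-- A monotone operator is maximal if its graph is not properly included in the graph of any
monotone operator. -/
def IsMaximalMonotoneOperator (T : X → Set (StrongDual ℝ X)) : Prop :=
  IsMonotoneOperator T ∧
    ∀ S : X → Set (StrongDual ℝ X), IsMonotoneOperator S → ¬ graph T ⊂ graph S

/-- A bifunction on `C` is represented by a map `F : X → X → ℝ` of which only the values on
`C × C` are ever used. It is monotone if `F x y + F y x ≤ 0` on `C`. -/
def IsMonotone (C : Set X) (F : X → X → ℝ) : Prop :=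
  ∀ x ∈ C, ∀ y ∈ C, F x y + F y x ≤ 0

/-- The operator `A^F : X ⇉ X*` attached to a bifunction `F` on `C`; it is empty outside `C`. -/
def assocOperator (C : Set X) (F : X → X → ℝ) (x : X) : Set (StrongDual ℝ X) :=
  {xs | x ∈ C ∧ ∀ y ∈ C, xs (y - x) ≤ F x y - F x x}

/-- A monotone bifunction `F` on `C` is maximal monotone if `A^F` is maximal monotone. -/
def IsMaximalMonotone (C : Set X) (F : X → X → ℝ) : Prop :=
  IsMonotone C F ∧ IsMaximalMonotoneOperator (assocOperator C F)

/-- Upper hemicontinuity on `C`: upper semicontinuity along each line segment in `C`. -/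
def UpperHemicontinuousOn (f : X → ℝ) (C : Set X) : Prop :=
  ∀ a b : X, segment ℝ a b ⊆ C → UpperSemicontinuousOn f (segment ℝ a b)

end MonotoneBifunction

/-!
For monotone `F`, Fan's theorem of the alternative gives, for finitely many `y ∈ C` and `ε > 0`, a
point `x ∈ C` with `F y x < ε`: otherwise some convex weights `w` on the `yᵢ` satisfy
`ε ≤ ∑ wᵢ F yᵢ x` on `C`, which convexity and monotonicity refute at the barycentre `x = ∑ wⱼ yⱼ`.
Weak compactness of the sublevel sets then yields `x` with `F y x ≤ 0` for all `y ∈ C`, and Minty's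
lemma turns this into `0 ≤ F x y` for all `y ∈ C`.

Given `(z, z*)`, this existence result applies to `F x y + G y - G x` with `G = ½‖· - z‖² - z*`,
since a closed convex function is minorized by an affine one and so its sum with `G` is coercive.
The solution `x` minimizes `F x · + G` over `C`, and the sandwich theorem splits this into
`x* ∈ A^F x` and `z* - x* ∈ ∂(½‖· - z‖²)(x)`. If `(z, z*)` is monotonically related to the graph of
`A^F`, the latter inclusion forces `x = z` and `x* = z*`.
-/

namespace MonotoneBifunction

open Set Filter Topology Bornology

section Subdifferential

variable {E : Type*} [AddCommGroup E] [Module ℝ E] [TopologicalSpace E]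

/-- The subdifferential at `x` of a function `g` on `C`: the set of slopes of the continuous affine
functions that minorize `g` on `C` and agree with it at `x`. It is the subdifferential in the sense
of convex analysis of the function equal to `g` on `C` and to `+∞` elsewhere; in particular it is
empty if `x ∉ C`. -/
def subdifferential (C : Set E) (g : E → ℝ) (x : E) : Set (StrongDual ℝ E) :=
  {f | x ∈ C ∧ ∀ y ∈ C, f (y - x) ≤ g y - g x}

theorem exists_affine_between_of_convexOn_of_concaveOn [IsTopologicalAddGroup E]
    [ContinuousSMul ℝ E] {C : Set E} {h k : E → ℝ} (hC : C.Nonempty) (hh : ConvexOn ℝ C h)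
    (hk : ConcaveOn ℝ univ k) (hkc : Continuous k) (hkh : ∀ y ∈ C, k y ≤ h y) :
    ∃ (f : StrongDual ℝ E) (a : ℝ), (∀ y, k y ≤ f y + a) ∧ ∀ y ∈ C, f y + a ≤ h y := by
  obtain ⟨x, hx⟩ := hC
  have hopen : IsOpen {p : E × ℝ | p.1 ∈ univ ∧ p.2 < k p.1} := by
    simpa using isOpen_lt continuous_snd (hkc.comp continuous_fst)
  have hdisj : Disjoint {p : E × ℝ | p.1 ∈ univ ∧ p.2 < k p.1} {p | p.1 ∈ C ∧ h p.1 ≤ p.2} :=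
    disjoint_left.2 fun p hpk hph => ((hkh p.1 hph.1).trans hph.2).not_gt hpk.2
  obtain ⟨φ, s, hφk, hφh⟩ := geometric_hahn_banach_open hk.convex_strict_hypograph hopen
    hh.convex_epigraph hdisj
  let g : StrongDual ℝ E := φ.comp (ContinuousLinearMap.inl ℝ E ℝ)
  let c : ℝ := φ (0, 1)
  have hφ (y : E) (t : ℝ) : φ (y, t) = g y + t * c := by
    rw [show ((y, t) : E × ℝ) = (y, 0) + t • (0, 1) by simp, map_add, map_smul]
    rfl
  have below (y : E) {t : ℝ} (ht : t < k y) : g y + t * c < s :=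
    hφ y t ▸ hφk (y, t) ⟨mem_univ y, ht⟩
  have above (y : E) (hy : y ∈ C) : s ≤ g y + h y * c := hφ y (h y) ▸ hφh (y, h y) ⟨hy, le_rfl⟩
  have hc : 0 < c := by
    nlinarith [below x (sub_one_lt (k x)), above x hx, hkh x hx]
  have happly (y : E) : (-(c⁻¹ • g)) y + s / c = (s - g y) / c := by
    simp only [neg_apply, smul_apply, smul_eq_mul]
    ring
  refine ⟨-(c⁻¹ • g), s / c, fun y => ?_, fun y hy => ?_⟩
  · refine le_of_forall_lt fun t ht => ?_
    rw [happly, lt_div_iff₀ hc]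
    linarith [below y ht]
  · rw [happly, div_le_iff₀ hc]
    linarith [above y hy]

theorem exists_mem_subdifferential_of_isMinOn_add [IsTopologicalAddGroup E] [ContinuousSMul ℝ E]
    {C : Set E} {h G : E → ℝ} (hh : ConvexOn ℝ C h) (hG : ConvexOn ℝ univ G) (hGc : Continuous G)
    {x : E} (hx : x ∈ C) (hmin : IsMinOn (fun y => h y + G y) C x) :
    ∃ f ∈ subdifferential C h x, -f ∈ subdifferential univ G x := by
  obtain ⟨f, a, hGf, hfh⟩ := exists_affine_between_of_convexOn_of_concaveOn
    (k := fun y => h x + G x - G y) ⟨x, hx⟩ hh ((concaveOn_const _ convex_univ).sub hG)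
    (by fun_prop) fun y hy => sub_le_iff_le_add.2 (hmin hy)
  have hfx : f x + a = h x := le_antisymm (hfh x hx) (by simpa using hGf x)
  refine ⟨f, ⟨hx, fun y hy => ?_⟩, mem_univ x, fun y _ => ?_⟩
  · rw [map_sub]
    linarith [hfh y hy]
  · rw [neg_apply, map_sub]
    linarith [hGf y]

end Subdifferential

section TheoremOfTheAlternative

theorem apply_nonneg_of_bddBelow_image_of_isUpperSet {V 𝓕 : Type*} [AddCommGroup V] [PartialOrder V]
    [IsOrderedAddMonoid V] [FunLike 𝓕 V ℝ] [AddMonoidHomClass 𝓕 V ℝ] {φ : 𝓕} {U : Set V}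
    (hU : IsUpperSet U) (hUne : U.Nonempty) (hφ : BddBelow (φ '' U)) {e : V} (he : 0 ≤ e) :
    0 ≤ φ e := by
  obtain ⟨v, hv⟩ := hUne
  obtain ⟨m, hm⟩ := hφ
  by_contra! hneg
  obtain ⟨n, hn⟩ := exists_lt_nsmul (neg_pos.2 hneg) (φ v - m)
  have hmem : v + n • e ∈ U := hU (le_add_of_nonneg_right (nsmul_nonneg he n)) hv
  have hle := hm (mem_image_of_mem φ hmem)
  rw [map_add, map_nsmul] at hle
  rw [smul_neg] at hn
  linarith

variable {E ι : Type*} [AddCommGroup E] [Module ℝ E] {C : Set E} {f : ι → E → ℝ}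

theorem convex_setOf_exists_forall_lt (hC : Convex ℝ C) (hf : ∀ i, ConvexOn ℝ C (f i)) :
    Convex ℝ {v : ι → ℝ | ∃ x ∈ C, ∀ i, f i x < v i} := by
  rintro v ⟨x, hx, hv⟩ w ⟨y, hy, hw⟩ a b ha hb hab
  exact ⟨a • x + b • y, hC hx hy ha hb hab, fun i =>
    ((hf i).convex_strict_epigraph (x := (x, v i)) ⟨hx, hv i⟩ (y := (y, w i)) ⟨hy, hw i⟩
      ha hb hab).2⟩

theorem isOpen_setOf_exists_forall_lt {α : Type*} [Finite ι] (s : Set α) (f : ι → α → ℝ) :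
    IsOpen {v : ι → ℝ | ∃ x ∈ s, ∀ i, f i x < v i} := by
  have heq : {v : ι → ℝ | ∃ x ∈ s, ∀ i, f i x < v i} =
      ⋃ x ∈ s, pi univ fun i => Ioi (f i x) := by
    ext v
    simp [Set.mem_pi]
  rw [heq]
  exact isOpen_biUnion fun x _ => isOpen_set_pi finite_univ fun i _ => isOpen_Ioi

theorem exists_mem_stdSimplex_forall_le_sum [Fintype ι] {c : ℝ} (hC : C.Nonempty)
    (hf : ∀ i, ConvexOn ℝ C (f i)) (hc : ∀ x ∈ C, ∃ i, c ≤ f i x) :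
    ∃ w ∈ stdSimplex ℝ ι, ∀ x ∈ C, c ≤ ∑ i, w i * f i x := by
  classical
  obtain ⟨x₀, hx₀⟩ := hC
  obtain ⟨i₀, -⟩ := hc x₀ hx₀
  set U : Set (ι → ℝ) := {v | ∃ x ∈ C, ∀ i, f i x < v i}
  have hU : IsUpperSet U := fun v w hvw ⟨x, hx, hv⟩ => ⟨x, hx, fun i => (hv i).trans_le (hvw i)⟩
  have hmem (x : E) (hx : x ∈ C) {ε : ℝ} (hε : 0 < ε) : (fun i => f i x + ε) ∈ U :=
    ⟨x, hx, fun i => lt_add_of_pos_right _ hε⟩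
  have hcU : (fun _ => c) ∉ U := fun ⟨x, hx, hlt⟩ => (hc x hx).elim fun i hi => (hlt i).not_ge hi
  obtain ⟨φ, hφ⟩ := geometric_hahn_banach_point_open
    (convex_setOf_exists_forall_lt (hf i₀).1 hf) (isOpen_setOf_exists_forall_lt C f) hcU
  let l : ι → ℝ := fun i => φ (Pi.single i 1)
  have hφl (v : ι → ℝ) : φ v = ∑ i, v i * l i := by
    conv_lhs => rw [pi_eq_sum_univ' v, map_sum]
    exact Finset.sum_congr rfl fun i _ => by rw [map_smul, smul_eq_mul]
  have hl (i : ι) : 0 ≤ l i := apply_nonneg_of_bddBelow_image_of_isUpperSet hU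
    ⟨_, hmem x₀ hx₀ one_pos⟩ ⟨_, forall_mem_image.2 fun v hv => (hφ v hv).le⟩
    (Pi.single_nonneg.2 zero_le_one)
  have hsum : 0 < ∑ i, l i := by
    refine (Finset.sum_nonneg fun i _ => hl i).lt_of_ne' fun h0 => ?_
    have hl0 (i : ι) : l i = 0 :=
      (Finset.sum_eq_zero_iff_of_nonneg fun i _ => hl i).1 h0 i (Finset.mem_univ i)
    simpa [hφl, hl0] using hφ _ (hmem x₀ hx₀ one_pos)
  refine ⟨fun i => l i / ∑ j, l j, ⟨fun i => div_nonneg (hl i) hsum.le, ?_⟩, fun x hx => ?_⟩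
  · rw [← Finset.sum_div, div_self hsum.ne']
  · refine le_of_forall_pos_le_add fun ε hε => ?_
    have hlt := hφ _ (hmem x hx hε)
    simp only [hφl, add_mul, Finset.sum_add_distrib, ← Finset.mul_sum] at hlt
    simp only [div_mul_eq_mul_div, ← Finset.sum_div, mul_comm (l _)]
    rw [← sub_le_iff_le_add, le_div_iff₀ hsum]
    linarith

end TheoremOfTheAlternative

variable {X : Type*} [NormedAddCommGroup X] [NormedSpace ℝ X] {C : Set X} {F : X → X → ℝ}

section WeakCompactness

theorem isClosed_toWeakSpace_image {K : Set X} (hconv : Convex ℝ K) (hclosed : IsClosed K) :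
    IsClosed (toWeakSpace ℝ X '' K) := by
  rw [← closure_eq_iff_isClosed, ← hconv.toWeakSpace_closure ℝ, hclosed.closure_eq]

theorem IsReflexive.isCompact_toWeakSpace_image (hX : IsReflexive X) {K : Set X}
    (hconv : Convex ℝ K) (hclosed : IsClosed K) (hbdd : IsBounded K) :
    IsCompact (toWeakSpace ℝ X '' K) := by
  have hsurj : Function.Surjective (NormedSpace.inclusionInDoubleDualWeak ℝ X) := fun ψ =>
    (hX (WeakDual.toStrongDual ψ)).imp fun x hx => congrArg StrongDual.toWeakDual hx
  rw [← (isClosed_toWeakSpace_image hconv hclosed).closure_eq]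
  refine NormedSpace.isCompact_closure_of_isBounded ℝ X _ ?_ ?_
  · rwa [preimage_image_eq _ (toWeakSpace ℝ X).injective]
  · rw [hsurj.range_eq]
    exact subset_univ _

theorem IsReflexive.nonempty_iInter (hX : IsReflexive X) {ι : Type*} {K : ι → Set X}
    (hconv : ∀ i, Convex ℝ (K i)) (hclosed : ∀ i, IsClosed (K i)) {i₀ : ι}
    (hbdd : IsBounded (K i₀)) (hfin : ∀ u : Finset ι, (⋂ i ∈ u, K i).Nonempty) :
    (⋂ i, K i).Nonempty := by
  classical
  obtain ⟨ξ, -, hξ⟩ := (hX.isCompact_toWeakSpace_image (hconv i₀) (hclosed i₀)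
    hbdd).inter_iInter_nonempty (fun i => toWeakSpace ℝ X '' K i)
    (fun i => isClosed_toWeakSpace_image (hconv i) (hclosed i)) fun u => by
      obtain ⟨x, hx⟩ := hfin (insert i₀ u)
      rw [mem_iInter₂] at hx
      exact ⟨toWeakSpace ℝ X x, mem_image_of_mem _ (hx i₀ (Finset.mem_insert_self i₀ u)),
        mem_iInter₂.2 fun i hi => mem_image_of_mem _ (hx i (Finset.mem_insert_of_mem hi))⟩
  rw [← image_iInter (toWeakSpace ℝ X).bijective] at hξ
  exact Nonempty.of_image ⟨ξ, hξ⟩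

end WeakCompactness

section Equilibrium

/-- The bifunctions considered in equilibrium problems: monotone bifunctions on `C` that vanish on
the diagonal, are convex and lower semicontinuous in the second variable, and are upper
hemicontinuous in the first one. -/
structure IsEquilibriumBifunction (C : Set X) (F : X → X → ℝ) : Prop where
  apply_self : ∀ x ∈ C, F x x = 0
  isMonotone : IsMonotone C F
  convexOn : ∀ x ∈ C, ConvexOn ℝ C (F x)
  lowerSemicontinuousOn : ∀ x ∈ C, LowerSemicontinuousOn (F x) C
  upperHemicontinuousOn : ∀ y ∈ C, UpperHemicontinuousOn (fun x => F x y) C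

theorem IsEquilibriumBifunction.add_sub (hF : IsEquilibriumBifunction C F) {G : X → ℝ}
    (hG : ConvexOn ℝ C G) (hGc : ContinuousOn G C) :
    IsEquilibriumBifunction C fun x y => F x y + (G y - G x) where
  apply_self x hx := by simp [hF.apply_self x hx]
  isMonotone x hx y hy := by linarith [hF.isMonotone x hx y hy]
  convexOn x hx := (hF.convexOn x hx).add (hG.sub (concaveOn_const (G x) hG.1))
  lowerSemicontinuousOn x hx := (hF.lowerSemicontinuousOn x hx).add
    (hGc.sub continuousOn_const).lowerSemicontinuousOn
  upperHemicontinuousOn y hy a b hab := (hF.upperHemicontinuousOn y hy a b hab).add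
    (continuousOn_const.sub (hGc.mono hab)).upperSemicontinuousOn

theorem IsMonotone.sum_mul_apply_sum_smul_nonpos (hmono : IsMonotone C F)
    (hconv : ∀ x ∈ C, ConvexOn ℝ C (F x)) {ι : Type*} [Fintype ι] {w : ι → ℝ}
    (hw : w ∈ stdSimplex ℝ ι) {p : ι → X} (hp : ∀ i, p i ∈ C) :
    ∑ i, w i * F (p i) (∑ j, w j • p j) ≤ 0 := by
  have hjensen (i : ι) : F (p i) (∑ j, w j • p j) ≤ ∑ j, w j * F (p i) (p j) :=
    (hconv (p i) (hp i)).map_sum_le (fun j _ => hw.1 j) hw.2 fun j _ => hp j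
  have hsymm : ∑ i, ∑ j, w i * w j * F (p i) (p j) = ∑ i, ∑ j, w i * w j * F (p j) (p i) := by
    rw [Finset.sum_comm]
    exact Finset.sum_congr rfl fun i _ => Finset.sum_congr rfl fun j _ => by ring
  have hdouble : ∑ i, ∑ j, w i * w j * (F (p i) (p j) + F (p j) (p i)) ≤ 0 :=
    Finset.sum_nonpos fun i _ => Finset.sum_nonpos fun j _ =>
      mul_nonpos_of_nonneg_of_nonpos (mul_nonneg (hw.1 i) (hw.1 j))
        (hmono (p i) (hp i) (p j) (hp j))
  simp only [mul_add, Finset.sum_add_distrib, ← hsymm] at hdouble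
  calc
    ∑ i, w i * F (p i) (∑ j, w j • p j) ≤ ∑ i, w i * ∑ j, w j * F (p i) (p j) :=
      Finset.sum_le_sum fun i _ => mul_le_mul_of_nonneg_left (hjensen i) (hw.1 i)
    _ = ∑ i, ∑ j, w i * w j * F (p i) (p j) := by simp only [Finset.mul_sum, mul_assoc]
    _ ≤ 0 := by linarith

theorem IsMonotone.exists_forall_mem_finset_lt (hmono : IsMonotone C F) (hne : C.Nonempty)
    (hconv : ∀ x ∈ C, ConvexOn ℝ C (F x)) {ε : ℝ} (hε : 0 < ε) {s : Finset X} (hs : ↑s ⊆ C) :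
    ∃ x ∈ C, ∀ y ∈ s, F y x < ε := by
  by_contra! hcon
  obtain ⟨x₀, hx₀⟩ := hne
  obtain ⟨w, hw, hle⟩ := exists_mem_stdSimplex_forall_le_sum (f := fun y : s => F y) ⟨x₀, hx₀⟩
    (fun y => hconv y (hs y.2)) fun x hx => let ⟨y, hy, hle⟩ := hcon x hx; ⟨⟨y, hy⟩, hle⟩
  have hbary : ∑ y : s, w y • (y : X) ∈ C :=
    (hconv x₀ hx₀).1.sum_mem (fun y _ => hw.1 y) hw.2 fun y _ => hs y.2
  exact ((hle _ hbary).trans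
    (hmono.sum_mul_apply_sum_smul_nonpos hconv hw fun y => hs y.2)).not_gt hε

theorem IsReflexive.exists_forall_apply_nonpos (hX : IsReflexive X) (hC : IsClosed C)
    (hmono : IsMonotone C F) (hconv : ∀ x ∈ C, ConvexOn ℝ C (F x))
    (hlsc : ∀ x ∈ C, LowerSemicontinuousOn (F x) C) {y₀ : X} (hy₀ : y₀ ∈ C) {r : ℝ} (hr : 0 < r)
    (hbdd : IsBounded {x ∈ C | F y₀ x ≤ r}) : ∃ x ∈ C, ∀ y ∈ C, F y x ≤ 0 := by
  classical
  let K : C × Ioi (0 : ℝ) → Set X := fun i => {x ∈ C | F i.1 x ≤ i.2}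
  have hclosed (i) : IsClosed (K i) := by
    obtain ⟨v, hv, hvK⟩ := lowerSemicontinuousOn_iff_preimage_Iic.1 (hlsc i.1 i.1.2) i.2
    exact (hvK ▸ hC.inter hv : IsClosed (C ∩ F i.1 ⁻¹' Iic (i.2 : ℝ)))
  have hfin (u : Finset (C × Ioi (0 : ℝ))) : (⋂ i ∈ u, K i).Nonempty := by
    obtain ⟨ε, hε⟩ := (u.image Prod.snd).bddBelow
    obtain ⟨x, hxC, hx⟩ := hmono.exists_forall_mem_finset_lt ⟨y₀, hy₀⟩ hconv ε.2
      (s := u.image fun i => (i.1 : X)) (by simp +contextual [subset_def])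
    exact ⟨x, mem_iInter₂.2 fun i hi => ⟨hxC, (hx i.1 (Finset.mem_image_of_mem _ hi)).le.trans
      (hε (Finset.mem_coe.2 (Finset.mem_image_of_mem _ hi)))⟩⟩
  obtain ⟨x, hx⟩ := hX.nonempty_iInter (K := K) (fun i => (hconv i.1 i.1.2).convex_le _)
    hclosed (i₀ := (⟨y₀, hy₀⟩, ⟨r, hr⟩)) hbdd hfin
  rw [mem_iInter] at hx
  exact ⟨x, (hx (⟨y₀, hy₀⟩, ⟨r, hr⟩)).1, fun y hy => le_of_forall_gt_imp_ge_of_dense fun ε hε =>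
    (hx (⟨y, hy⟩, ⟨ε, hε⟩)).2⟩

theorem apply_nonneg_of_forall_apply_nonpos (hself : ∀ x ∈ C, 0 ≤ F x x)
    (hconv : ∀ x ∈ C, ConvexOn ℝ C (F x)) {x y : X} (hx : x ∈ C) (hy : y ∈ C)
    (husc : UpperHemicontinuousOn (fun x => F x y) C) (hdual : ∀ z ∈ C, F z x ≤ 0) :
    0 ≤ F x y := by
  let p : ℝ → X := AffineMap.lineMap x y
  have hC : Convex ℝ C := (hconv x hx).1
  have hunit : ∀ᶠ t : ℝ in 𝓝[>] 0, t ∈ Ioo 0 1 := Ioo_mem_nhdsGT zero_lt_one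
  have hp : Tendsto p (𝓝[>] 0) (𝓝[segment ℝ x y] x) := by
    refine tendsto_nhdsWithin_iff.2 ⟨?_, hunit.mono fun t ht => ?_⟩
    · simpa [p] using ((AffineMap.lineMap_continuous (p := x) (q := y)).tendsto (0 : ℝ)).mono_left
        nhdsWithin_le_nhds
    · exact segment_eq_image_lineMap ℝ x y ▸ mem_image_of_mem _ (Ioo_subset_Icc_self ht)
  by_contra! hneg
  have hev := husc x y (hC.segment_subset hx hy) x (left_mem_segment ℝ x y) 0 hneg
  obtain ⟨t, htneg, ht0, ht1⟩ := ((hp.eventually hev).and hunit).exists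
  have hpt : p t ∈ C := hC.lineMap_mem hx hy ⟨ht0.le, ht1.le⟩
  have hle : F (p t) (p t) ≤ (1 - t) * F (p t) x + t * F (p t) y := by
    have := (hconv (p t) hpt).2 hx hy (sub_nonneg.2 ht1.le) ht0.le (sub_add_cancel 1 t)
    rwa [← AffineMap.lineMap_apply_module] at this
  linarith [hself (p t) hpt, mul_neg_of_pos_of_neg ht0 htneg,
    mul_nonpos_of_nonneg_of_nonpos (sub_nonneg.2 ht1.le) (hdual (p t) hpt)]

theorem IsReflexive.exists_forall_apply_nonneg (hX : IsReflexive X) (hC : IsClosed C)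
    (hF : IsEquilibriumBifunction C F) {y₀ : X} (hy₀ : y₀ ∈ C) {r : ℝ} (hr : 0 < r)
    (hbdd : IsBounded {x ∈ C | F y₀ x ≤ r}) : ∃ x ∈ C, ∀ y ∈ C, 0 ≤ F x y := by
  obtain ⟨x, hx, hdual⟩ := hX.exists_forall_apply_nonpos hC hF.isMonotone hF.convexOn
    hF.lowerSemicontinuousOn hy₀ hr hbdd
  exact ⟨x, hx, fun y hy => apply_nonneg_of_forall_apply_nonpos
    (fun z hz => (hF.apply_self z hz).ge) hF.convexOn hx hy (hF.upperHemicontinuousOn y hy) hdual⟩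

end Equilibrium

section HalfSqDist

theorem convexOn_half_norm_sub_sq (z : X) : ConvexOn ℝ univ fun x => ‖x - z‖ ^ 2 / 2 := by
  simp only [← dist_eq_norm, div_eq_inv_mul]
  exact ((convexOn_dist z convex_univ).pow (fun _ _ => dist_nonneg) 2).smul (by norm_num)

theorem isBounded_setOf_apply_add_half_norm_sub_sq_le (f : StrongDual ℝ X) (z : X) (r : ℝ) :
    IsBounded {x | f x + ‖x - z‖ ^ 2 / 2 ≤ r} := by
  refine (Metric.isBounded_closedBall (x := z) (r := 2 * ‖f‖ + |r - f z| + 1)).subset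
    fun x (hx : _ ≤ r) => ?_
  rw [Metric.mem_closedBall, dist_eq_norm]
  have hf : f z - f x ≤ ‖f‖ * ‖x - z‖ := by
    rw [← map_sub, norm_sub_rev]
    exact (le_abs_self _).trans (f.le_opNorm _)
  by_contra! hlt
  nlinarith [norm_nonneg f, abs_nonneg (r - f z), le_abs_self (r - f z)]

theorem isBounded_sublevel_add_half_norm_sub_sq {h : X → ℝ} (hC : IsClosed C)
    (hconv : ConvexOn ℝ C h) (hlsc : LowerSemicontinuousOn h C) (z : X) (r : ℝ) :
    IsBounded {x ∈ C | h x + ‖x - z‖ ^ 2 / 2 ≤ r} := by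
  obtain rfl | ⟨x₀, hx₀⟩ := C.eq_empty_or_nonempty
  · simp
  obtain ⟨f, c, hfh, -⟩ := hconv.exists_affine_le_of_lt (𝕜 := ℝ) hx₀ (sub_one_lt (h x₀)) hC hlsc
  refine (isBounded_setOf_apply_add_half_norm_sub_sq_le f z (r - c)).subset fun x ⟨hxC, hxr⟩ => ?_
  have hfx : f x + c ≤ h x := hfh ⟨x, hxC⟩
  rw [mem_ofPred_eq]
  linarith

theorem eq_zero_of_mem_subdifferential_of_hasFDerivAt_zero {g : X → ℝ} {x : X}
    {f : StrongDual ℝ X} (hf : f ∈ subdifferential univ g x)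
    (hg : HasFDerivAt g (0 : StrongDual ℝ X) x) : f = 0 := by
  have hmin : IsLocalMin (fun y => g y - f y) x := Eventually.of_forall fun y => by
    have := hf.2 y (mem_univ y)
    rw [map_sub] at this
    linarith
  simpa using hmin.hasFDerivAt_eq_zero (hg.sub f.hasFDerivAt)

theorem eq_and_eq_zero_of_mem_subdifferential_half_norm_sub_sq {x z : X} {f : StrongDual ℝ X}
    (hf : f ∈ subdifferential univ (fun y => ‖y - z‖ ^ 2 / 2) x) (hle : f (x - z) ≤ 0) :
    x = z ∧ f = 0 := by
  have hz : f (z - x) ≤ ‖z - z‖ ^ 2 / 2 - ‖x - z‖ ^ 2 / 2 := hf.2 z (mem_univ z)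
  rw [← neg_sub x z, map_neg, sub_self, norm_zero] at hz
  obtain rfl : x = z := by
    rw [← sub_eq_zero, ← norm_eq_zero, ← sq_eq_zero_iff]
    linarith [sq_nonneg ‖x - z‖]
  refine ⟨rfl, eq_zero_of_mem_subdifferential_of_hasFDerivAt_zero hf ?_⟩
  refine Asymptotics.IsBigO.hasFDerivAt (n := 2) ?_ one_lt_two
  simp only [div_eq_inv_mul]
  exact Asymptotics.isBigO_const_mul_self _ _ _

end HalfSqDist

section MaximalMonotone

theorem IsMonotone.isMonotoneOperator_assocOperator (hF : IsMonotone C F)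
    (hself : ∀ x ∈ C, 0 ≤ F x x) : IsMonotoneOperator (assocOperator C F) := by
  rintro x y xs ⟨hx, hxs⟩ ys ⟨hy, hys⟩
  have hxy := hxs y hy
  have hyx := hys x hx
  rw [← neg_sub y x, map_neg] at hyx
  rw [sub_apply]
  linarith [hF x hx y hy, hself x hx, hself y hy]

theorem IsMonotoneOperator.isMaximalMonotoneOperator {T : X → Set (StrongDual ℝ X)}
    (hT : IsMonotoneOperator T)
    (hres : ∀ z zs, ∃ x, ∃ xs ∈ T x, zs - xs ∈ subdifferential univ (fun y => ‖y - z‖ ^ 2 / 2) x) :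
    IsMaximalMonotoneOperator T := by
  refine ⟨hT, fun S hS hTS => hTS.2 fun ⟨z, zs⟩ hz => ?_⟩
  obtain ⟨x, xs, hxs, hsub⟩ := hres z zs
  have hxS : xs ∈ S x := hTS.1 (show (x, xs) ∈ graph T from hxs)
  have hle : (zs - xs) (x - z) ≤ 0 := by
    rw [← neg_sub xs zs, neg_apply]
    exact neg_nonpos.2 (hS z x zs hz xs hxS)
  obtain ⟨rfl, heq⟩ := eq_and_eq_zero_of_mem_subdifferential_half_norm_sub_sq hsub hle
  exact sub_eq_zero.1 heq ▸ hxs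

theorem IsReflexive.exists_mem_assocOperator_neg_mem_subdifferential (hX : IsReflexive X)
    (hC : IsClosed C) (hF : IsEquilibriumBifunction C F) {G : X → ℝ} (hG : ConvexOn ℝ univ G)
    (hGc : Continuous G) {y₀ : X} (hy₀ : y₀ ∈ C) {r : ℝ} (hr : G y₀ < r)
    (hbdd : IsBounded {x ∈ C | F y₀ x + G x ≤ r}) :
    ∃ x, ∃ xs ∈ assocOperator C F x, -xs ∈ subdifferential univ G x := by
  have hGC : ConvexOn ℝ C G := hG.subset (subset_univ C) (hF.convexOn y₀ hy₀).1
  obtain ⟨x, hx, hxmin⟩ := hX.exists_forall_apply_nonneg hC (hF.add_sub hGC hGc.continuousOn) hy₀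
    (sub_pos.2 hr) (by simpa only [← add_sub_assoc, sub_le_sub_iff_right] using hbdd)
  have hmin : IsMinOn (fun y => F x y + G y) C x := fun y hy => by
    change F x x + G x ≤ F x y + G y
    linarith [hxmin y hy, hF.apply_self x hx]
  exact ⟨x, exists_mem_subdifferential_of_isMinOn_add (hF.convexOn x hx) hG hGc hx hmin⟩

theorem IsReflexive.exists_mem_assocOperator_sub_mem_subdifferential (hX : IsReflexive X)
    (hCne : C.Nonempty) (hC : IsClosed C) (hF : IsEquilibriumBifunction C F) (z : X)
    (zs : StrongDual ℝ X) :
    ∃ x, ∃ xs ∈ assocOperator C F x,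
      zs - xs ∈ subdifferential univ (fun y => ‖y - z‖ ^ 2 / 2) x := by
  obtain ⟨y₀, hy₀⟩ := hCne
  let G : X → ℝ := fun x => ‖x - z‖ ^ 2 / 2 - zs x
  have hG : ConvexOn ℝ univ G :=
    (convexOn_half_norm_sub_sq z).sub (zs.toLinearMap.concaveOn convex_univ)
  have hbdd : IsBounded {x ∈ C | F y₀ x + G x ≤ G y₀ + 1} := by
    have hconv := (hF.convexOn y₀ hy₀).sub (zs.toLinearMap.concaveOn (hF.convexOn y₀ hy₀).1)
    have hlsc := (hF.lowerSemicontinuousOn y₀ hy₀).add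
      (-zs).continuous.continuousOn.lowerSemicontinuousOn
    refine (isBounded_sublevel_add_half_norm_sub_sq hC (h := fun y => F y₀ y - zs y) hconv
      (by simpa [sub_eq_add_neg] using hlsc) z (G y₀ + 1)).subset fun x ⟨hxC, hxr⟩ => ⟨hxC, ?_⟩
    simpa [G, sub_add_eq_add_sub, add_sub_assoc] using hxr
  obtain ⟨x, xs, hxs, hsub⟩ := hX.exists_mem_assocOperator_neg_mem_subdifferential hC hF hG
    (by fun_prop) hy₀ (lt_add_one (G y₀)) hbdd
  refine ⟨x, xs, hxs, mem_univ x, fun y hy => ?_⟩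
  have := hsub.2 y hy
  simp only [G, neg_apply] at this
  rw [sub_apply, map_sub zs]
  linarith

end MaximalMonotone

end MonotoneBifunction

theorem mainTheorem7 {X : Type*} [NormedAddCommGroup X] [NormedSpace ℝ X] [CompleteSpace X]
    (hX : MonotoneBifunction.IsReflexive X)
    (C : Set X) (hCne : C.Nonempty) (hCconv : Convex ℝ C) (hCclosed : IsClosed C)
    (F : X → X → ℝ)
    (hF0 : ∀ x ∈ C, F x x = 0)
    (hFmono : MonotoneBifunction.IsMonotone C F)
    (hFconv : ∀ x ∈ C, ConvexOn ℝ C (fun y => F x y))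
    (hFlsc : ∀ x ∈ C, LowerSemicontinuousOn (fun y => F x y) C)
    (hFusc : ∀ y ∈ C, MonotoneBifunction.UpperHemicontinuousOn (fun x => F x y) C) :
    MonotoneBifunction.IsMaximalMonotone C F := by
  have hF : MonotoneBifunction.IsEquilibriumBifunction C F := ⟨hF0, hFmono, hFconv, hFlsc, hFusc⟩
  have hA : MonotoneBifunction.IsMonotoneOperator (MonotoneBifunction.assocOperator C F) :=
    hFmono.isMonotoneOperator_assocOperator fun x hx => (hF0 x hx).ge
  exact ⟨hFmono, hA.isMaximalMonotoneOperator
    (hX.exists_mem_assocOperator_sub_mem_subdifferential hCne hCclosed hF)⟩
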